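/- Let $M$ be a compact $n$-dimensional smooth manifold (without boundary), let $p,l\ge 0$ be integers, and let $\omega=\{\omega(t)\}_{t\in\mathbb{R}^l}$ be a family of $p$-forms on $M$. Fix a finite family of smooth charts $\phi_i:U_i\to\mathbb{R}^n$ of $M$ and a smooth partition of unity $\{\lambda_i\}$ with $\operatorname{supp}\lambda_i\subset U_i$. For $k\ge 0$ let $C^k(M,\Lambda^p)$ be the Banach space of $p$-forms on $M$ of class $C^k$, with the norm $$\|\eta\|_{C^k(M)}:=\sum_i\ \sum_{|\alpha|\le k}\ \sup_{x\in\mathbb{R}^n}\bigl|\partial_x^\alpha\bigl(\phi_{i*}(\lambda_i\eta)\bigr)(x)\bigr|,$$ where $\phi_{i*}(\lambda_i\eta)$ is the vector of coefficients of $\lambda_i\eta$ in the chart $\phi_i$, extended by zero to $\mathbb{R}^n$. Then the following are equivalent. 1. $\omega$ is a smooth family: in all local coordinates $x_1,\dots,x_n$ of $M$, the coefficients of $\omega(t)$ are smooth ($C^\infty$) functions of $(t,x)$ jointly. 2. For every integer $k\ge 0$, each $\omega(t)$ belongs to $C^k(M,\Lambda^p)$, and the map $\mathbb{R}^l\to C^k(M,\Lambda^p)$,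 $t\mapsto\omega(t)$, is smooth ($C^\infty$ in the sense of Fréchet derivatives between normed spaces). -/

import Mathlib

open scoped Manifold ContDiff

noncomputable section

namespace FormFamily

/-! ### Partial derivatives of vector valued functions on `ℝⁿ` -/

section PartialDerivatives

variable {n : ℕ} {V : Type*} [NormedAddCommGroup V] [NormedSpace ℝ V]

/-- The partial derivative `∂f/∂xᵢ`. -/
def pderiv (i : Fin n) (f : EuclideanSpace ℝ (Fin n) → V) : EuclideanSpace ℝ (Fin n) → V :=
  fun y => fderiv ℝ f y (EuclideanSpace.single i (1 : ℝ))

/-- The mixed partial derivative given by a multi-index `α` along a list of directions: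
for the list `[i₁, …, iᵣ]` it is `∂_{i₁}^{α i₁} ⋯ ∂_{iᵣ}^{α iᵣ} f`. -/
def pderivList (α : Fin n → ℕ) (L : List (Fin n)) (f : EuclideanSpace ℝ (Fin n) → V) :
    EuclideanSpace ℝ (Fin n) → V :=
  L.foldr (fun i g => (pderiv i)^[α i] g) f

/-- `∂^α f = ∂₁^{α₁} ⋯ ∂ₙ^{αₙ} f`. -/
def mpderiv (α : Fin n → ℕ) (f : EuclideanSpace ℝ (Fin n) → V) : EuclideanSpace ℝ (Fin n) → V :=
  pderivList α (List.finRange n) f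

/-- The `C^k` norm `∑_{|α| ≤ k} sup_y |∂^α f(y)|`. -/
def ckNorm (k : ℕ) (f : EuclideanSpace ℝ (Fin n) → V) : ℝ :=
  ∑ j ∈ Finset.range (k + 1), ∑ α ∈ Finset.Nat.antidiagonalTuple n j,
    ⨆ y : EuclideanSpace ℝ (Fin n), ‖mpderiv α f y‖

lemma contDiff_pderiv {m : ℕ} (i : Fin n) {f : EuclideanSpace ℝ (Fin n) → V}
    (hf : ContDiff ℝ ((m + 1 : ℕ) : ℕ∞) f) : ContDiff ℝ (m : ℕ∞) (pderiv i f) := by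
  have h : ContDiff ℝ (m : ℕ∞) (fderiv ℝ f) := hf.fderiv_right (by norm_cast)
  exact h.clm_apply contDiff_const

lemma contDiff_pderiv_iterate (i : Fin n) (a m : ℕ) {f : EuclideanSpace ℝ (Fin n) → V}
    (hf : ContDiff ℝ ((m + a : ℕ) : ℕ∞) f) : ContDiff ℝ (m : ℕ∞) ((pderiv i)^[a] f) := by
  induction a generalizing f with
  | zero => simpa using hf
  | succ a ih =>
    rw [Function.iterate_succ_apply]
    exact ih (contDiff_pderiv i hf)

lemma contDiff_pderivList (α : Fin n → ℕ) (L : List (Fin n)) (m : ℕ)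
    {f : EuclideanSpace ℝ (Fin n) → V}
    (hf : ContDiff ℝ ((m + (L.map α).sum : ℕ) : ℕ∞) f) :
    ContDiff ℝ (m : ℕ∞) (pderivList α L f) := by
  induction L generalizing m with
  | nil => simpa [pderivList] using hf
  | cons i L ih =>
    refine contDiff_pderiv_iterate i (α i) m (ih (m + α i) ?_)
    simpa [add_assoc] using hf

lemma pderiv_add (i : Fin n) {f g : EuclideanSpace ℝ (Fin n) → V}
    (hf : Differentiable ℝ f) (hg : Differentiable ℝ g) :
    pderiv i (f + g) = pderiv i f + pderiv i g := by
  ext1 y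
  simp [pderiv, fderiv_add (hf y) (hg y)]

lemma pderiv_smul (i : Fin n) (c : ℝ) {f : EuclideanSpace ℝ (Fin n) → V}
    (hf : Differentiable ℝ f) : pderiv i (c • f) = c • pderiv i f := by
  ext1 y
  simp [pderiv, fderiv_const_smul (hf y)]

lemma pderiv_iterate_add (i : Fin n) (a : ℕ) {f g : EuclideanSpace ℝ (Fin n) → V}
    (hf : ContDiff ℝ (a : ℕ∞) f) (hg : ContDiff ℝ (a : ℕ∞) g) :
    (pderiv i)^[a] (f + g) = (pderiv i)^[a] f + (pderiv i)^[a] g := by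
  induction a generalizing f g with
  | zero => rfl
  | succ a ih =>
    simp only [Function.iterate_succ_apply]
    rw [pderiv_add i (hf.differentiable (by simp)) (hg.differentiable (by simp)),
      ih (contDiff_pderiv i hf) (contDiff_pderiv i hg)]

lemma pderiv_iterate_smul (i : Fin n) (a : ℕ) (c : ℝ) {f : EuclideanSpace ℝ (Fin n) → V}
    (hf : ContDiff ℝ (a : ℕ∞) f) :
    (pderiv i)^[a] (c • f) = c • (pderiv i)^[a] f := by
  induction a generalizing f with
  | zero => rfl
  | succ a ih =>
    simp only [Function.iterate_succ_apply]
    rw [pderiv_smul i c (hf.differentiable (by simp)), ih (contDiff_pderiv i hf)]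

lemma pderivList_add (α : Fin n → ℕ) (L : List (Fin n)) {f g : EuclideanSpace ℝ (Fin n) → V}
    (hf : ContDiff ℝ ((L.map α).sum : ℕ∞) f) (hg : ContDiff ℝ ((L.map α).sum : ℕ∞) g) :
    pderivList α L (f + g) = pderivList α L f + pderivList α L g := by
  induction L with
  | nil => rfl
  | cons i L ih =>
    have hle : (((L.map α).sum : ℕ∞) : WithTop ℕ∞) ≤ (((i :: L).map α).sum : ℕ∞) := by
      norm_cast; simp
    have hf' : ContDiff ℝ ((α i + (L.map α).sum : ℕ) : ℕ∞) f := by simpa using hf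
    have hg' : ContDiff ℝ ((α i + (L.map α).sum : ℕ) : ℕ∞) g := by simpa using hg
    change (pderiv i)^[α i] (pderivList α L (f + g)) = _
    rw [ih (hf.of_le hle) (hg.of_le hle), pderiv_iterate_add i (α i)
      (contDiff_pderivList α L (α i) hf') (contDiff_pderivList α L (α i) hg')]
    rfl

lemma pderivList_smul (α : Fin n → ℕ) (L : List (Fin n)) (c : ℝ)
    {f : EuclideanSpace ℝ (Fin n) → V} (hf : ContDiff ℝ ((L.map α).sum : ℕ∞) f) :
    pderivList α L (c • f) = c • pderivList α L f := by
  induction L with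
  | nil => rfl
  | cons i L ih =>
    have hle : (((L.map α).sum : ℕ∞) : WithTop ℕ∞) ≤ (((i :: L).map α).sum : ℕ∞) := by
      norm_cast; simp
    have hf' : ContDiff ℝ ((α i + (L.map α).sum : ℕ) : ℕ∞) f := by simpa using hf
    change (pderiv i)^[α i] (pderivList α L (c • f)) = _
    rw [ih (hf.of_le hle), pderiv_iterate_smul i (α i) c (contDiff_pderivList α L (α i) hf')]
    rfl

lemma hasCompactSupport_pderivList (α : Fin n → ℕ) (L : List (Fin n))
    {f : EuclideanSpace ℝ (Fin n) → V} (hf : HasCompactSupport f) :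
    HasCompactSupport (pderivList α L f) := by
  have key : ∀ (i : Fin n) (a : ℕ) (g : EuclideanSpace ℝ (Fin n) → V), HasCompactSupport g →
      HasCompactSupport ((pderiv i)^[a] g) := by
    intro i a
    induction a with
    | zero => exact fun g hg => hg
    | succ a ih =>
      intro g hg
      rw [Function.iterate_succ_apply]
      exact ih _ (hg.fderiv_apply (𝕜 := ℝ) _)
  induction L with
  | nil => exact hf
  | cons i L ih => exact key i (α i) _ ih

lemma sum_map_finRange (α : Fin n → ℕ) : ((List.finRange n).map α).sum = ∑ i, α i := by
  rw [Fin.sum_univ_def]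

lemma bddAbove_mpderiv {α : Fin n → ℕ} {f : EuclideanSpace ℝ (Fin n) → V}
    (hf : ContDiff ℝ ((∑ i, α i : ℕ) : ℕ∞) f) (hc : HasCompactSupport f) :
    BddAbove (Set.range fun y => ‖mpderiv α f y‖) := by
  have h0 : ContDiff ℝ ((0 : ℕ) : ℕ∞) (mpderiv α f) :=
    contDiff_pderivList α _ 0 (by rw [sum_map_finRange, zero_add]; exact hf)
  obtain ⟨C, hC⟩ := (hasCompactSupport_pderivList α (List.finRange n) hc).exists_bound_of_continuous
    h0.continuous
  exact ⟨C, by rintro _ ⟨y, rfl⟩; exact hC y⟩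

lemma mpderiv_add {α : Fin n → ℕ} {f g : EuclideanSpace ℝ (Fin n) → V}
    (hf : ContDiff ℝ ((∑ i, α i : ℕ) : ℕ∞) f) (hg : ContDiff ℝ ((∑ i, α i : ℕ) : ℕ∞) g) :
    mpderiv α (f + g) = mpderiv α f + mpderiv α g :=
  pderivList_add α _ (by rw [sum_map_finRange]; exact hf) (by rw [sum_map_finRange]; exact hg)

lemma mpderiv_smul {α : Fin n → ℕ} (c : ℝ) {f : EuclideanSpace ℝ (Fin n) → V}
    (hf : ContDiff ℝ ((∑ i, α i : ℕ) : ℕ∞) f) : mpderiv α (c • f) = c • mpderiv α f :=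
  pderivList_smul α _ c (by rw [sum_map_finRange]; exact hf)

lemma ckNorm_nonneg (k : ℕ) (f : EuclideanSpace ℝ (Fin n) → V) : 0 ≤ ckNorm k f :=
  Finset.sum_nonneg fun _ _ => Finset.sum_nonneg fun _ _ => Real.iSup_nonneg fun _ => norm_nonneg _

lemma contDiff_of_mem {k j : ℕ} (hj : j ∈ Finset.range (k + 1)) {α : Fin n → ℕ}
    (hα : α ∈ Finset.Nat.antidiagonalTuple n j) {f : EuclideanSpace ℝ (Fin n) → V}
    (hf : ContDiff ℝ (k : ℕ∞) f) : ContDiff ℝ ((∑ i, α i : ℕ) : ℕ∞) f := by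
  rw [Finset.Nat.mem_antidiagonalTuple] at hα
  refine hf.of_le ?_
  rw [hα]
  have := Finset.mem_range_succ_iff.1 hj
  exact_mod_cast this

lemma ckNorm_add_le (k : ℕ) {f g : EuclideanSpace ℝ (Fin n) → V}
    (hf : ContDiff ℝ (k : ℕ∞) f) (hg : ContDiff ℝ (k : ℕ∞) g)
    (hfc : HasCompactSupport f) (hgc : HasCompactSupport g) :
    ckNorm k (f + g) ≤ ckNorm k f + ckNorm k g := by
  simp only [ckNorm, ← Finset.sum_add_distrib]
  refine Finset.sum_le_sum fun j hj => Finset.sum_le_sum fun α hα => ?_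
  have hf' := contDiff_of_mem hj hα hf
  have hg' := contDiff_of_mem hj hα hg
  refine ciSup_le fun y => ?_
  rw [mpderiv_add hf' hg']
  exact (norm_add_le _ _).trans (add_le_add (le_ciSup (bddAbove_mpderiv hf' hfc) y)
    (le_ciSup (bddAbove_mpderiv hg' hgc) y))

lemma ckNorm_smul (k : ℕ) (c : ℝ) {f : EuclideanSpace ℝ (Fin n) → V}
    (hf : ContDiff ℝ (k : ℕ∞) f) : ckNorm k (c • f) = |c| * ckNorm k f := by
  simp only [ckNorm, Finset.mul_sum]
  refine Finset.sum_congr rfl fun j hj => Finset.sum_congr rfl fun α hα => ?_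
  rw [mpderiv_smul c (contDiff_of_mem hj hα hf), Real.mul_iSup_of_nonneg (abs_nonneg c)]
  simp [norm_smul]

lemma eq_zero_of_ckNorm_eq_zero (k : ℕ) {f : EuclideanSpace ℝ (Fin n) → V}
    (hf : ContDiff ℝ (k : ℕ∞) f) (hfc : HasCompactSupport f) (h : ckNorm k f = 0) : f = 0 := by
  have h0 : (0 : ℕ) ∈ Finset.range (k + 1) := by simp
  have hα : (0 : Fin n → ℕ) ∈ Finset.Nat.antidiagonalTuple n 0 := by
    simp [Finset.Nat.mem_antidiagonalTuple]
  have hnn : ∀ α : Fin n → ℕ, 0 ≤ ⨆ y : EuclideanSpace ℝ (Fin n), ‖mpderiv α f y‖ :=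
    fun α => Real.iSup_nonneg fun _ => norm_nonneg _
  have h1 := (Finset.sum_eq_zero_iff_of_nonneg
    (fun j _ => Finset.sum_nonneg fun α _ => hnn α)).1 h 0 h0
  have h2 := (Finset.sum_eq_zero_iff_of_nonneg (fun α _ => hnn α)).1 h1 0 hα
  have h3 : mpderiv (0 : Fin n → ℕ) f = f := by
    have : ∀ L : List (Fin n), pderivList 0 L f = f := by
      intro L
      induction L with
      | nil => rfl
      | cons i L ih => exact ih
    exact this _
  ext1 y
  have h4 := le_ciSup (bddAbove_mpderiv (contDiff_of_mem h0 hα hf) hfc) y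
  rw [h2, h3] at h4
  simpa using h4

end PartialDerivatives

/-! ### Differential forms in local coordinates -/

section Forms

variable {n p : ℕ} {M : Type*} [TopologicalSpace M] [ChartedSpace (EuclideanSpace ℝ (Fin n)) M]

variable (n p M) in
/-- A (not necessarily continuous) differential `p`-form on `M`: an alternating `p`-linear form on
every tangent space. -/
abbrev Form : Type _ := (x : M) → (TangentSpace (𝓡 n) x) [⋀^Fin p]→L[ℝ] ℝ

/-- The coordinate vector field `∂/∂xᵢ` of the chart `φ`, at the point of `M` with
coordinates `y`. -/
def coordVector (φ : OpenPartialHomeomorph M (EuclideanSpace ℝ (Fin n)))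
    (y : EuclideanSpace ℝ (Fin n)) (i : Fin n) : TangentSpace (𝓡 n) (φ.symm y) :=
  mfderiv (𝓡 n) (𝓡 n) φ.symm y (EuclideanSpace.single i (1 : ℝ))

/-- The vector of coefficients of the form `η` in the chart `φ`, as a function of the coordinates
`y`: if `η = ∑ η_{s₁ ⋯ s_p} dx_{s₁} ∧ ⋯ ∧ dx_{s_p}` (sum over `s₁ < ⋯ < s_p`), then the
component with index `s` is `η_{s₁ ⋯ s_p}`. Only meaningful for `y ∈ φ.target`. -/
def coeff (φ : OpenPartialHomeomorph M (EuclideanSpace ℝ (Fin n))) (η : Form n p M)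
    (y : EuclideanSpace ℝ (Fin n)) : EuclideanSpace ℝ (Fin p ↪o Fin n) :=
  WithLp.toLp 2 fun s => η (φ.symm y) fun a => coordVector φ y (s a)

/-- A family of `p`-forms with parameter `t ∈ ℝˡ` is smooth if in all local coordinates its
coefficients are smooth functions of `(t, x)` jointly. -/
def IsSmoothFamily {l : ℕ} (η : EuclideanSpace ℝ (Fin l) → Form n p M) : Prop :=
  ∀ φ ∈ IsManifold.maximalAtlas (𝓡 n) ∞ M,
    ContDiffOn ℝ ∞
      (fun q : EuclideanSpace ℝ (Fin l) × EuclideanSpace ℝ (Fin n) => coeff φ (η q.1) q.2)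
      (Set.univ ×ˢ φ.target)

/-- A form is of class `C^k` if in all local coordinates its coefficients are of class `C^k`. -/
def IsCk (k : ℕ) (η : Form n p M) : Prop :=
  ∀ φ ∈ IsManifold.maximalAtlas (𝓡 n) ∞ M, ContDiffOn ℝ (k : ℕ∞) (coeff φ η) φ.target

lemma coeff_add (φ : OpenPartialHomeomorph M (EuclideanSpace ℝ (Fin n))) (η θ : Form n p M) :
    coeff φ (η + θ) = coeff φ η + coeff φ θ := rfl

lemma coeff_smul (φ : OpenPartialHomeomorph M (EuclideanSpace ℝ (Fin n))) (c : ℝ)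
    (η : Form n p M) : coeff φ (c • η) = c • coeff φ η := rfl

variable (n M) in
/-- A finite family of charts of `M`, with a smooth partition of unity such that the support of
each member lies in the domain of the corresponding chart. -/
structure ChartPartition (ι : Type*) where
  /-- The charts. -/
  chart : ι → OpenPartialHomeomorph M (EuclideanSpace ℝ (Fin n))
  chart_mem : ∀ i, chart i ∈ IsManifold.maximalAtlas (𝓡 n) ∞ M
  /-- The partition of unity. -/
  pou : SmoothPartitionOfUnity ι (𝓡 n) M
  subordinate : ∀ i, tsupport (pou i) ⊆ (chart i).source

variable {ι : Type*}

open scoped Classical in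
/-- The coefficients of the form `λᵢ η` in the `i`-th chart, extended by zero to a function
on `ℝⁿ`. -/
def ChartPartition.localCoeff (D : ChartPartition n M ι) (i : ι) (η : Form n p M)
    (y : EuclideanSpace ℝ (Fin n)) : EuclideanSpace ℝ (Fin p ↪o Fin n) :=
  if y ∈ (D.chart i).target then
    coeff (D.chart i) (fun x => D.pou i x • η x) y
  else 0

lemma mdifferentiable_of_mem {φ : OpenPartialHomeomorph M (EuclideanSpace ℝ (Fin n))}
    [IsManifold (𝓡 n) ∞ M] (hφ : φ ∈ IsManifold.maximalAtlas (𝓡 n) ∞ M) :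
    φ.MDifferentiable (𝓡 n) (𝓡 n) :=
  ⟨(contMDiffOn_of_mem_maximalAtlas hφ).mdifferentiableOn (by simp),
    (contMDiffOn_symm_of_mem_maximalAtlas hφ).mdifferentiableOn (by simp)⟩

/-- A form vanishes at a point if its coefficients do. -/
lemma eq_zero_of_coeff_eq_zero [IsManifold (𝓡 n) ∞ M]
    {φ : OpenPartialHomeomorph M (EuclideanSpace ℝ (Fin n))}
    (hφ : φ ∈ IsManifold.maximalAtlas (𝓡 n) ∞ M) {y : EuclideanSpace ℝ (Fin n)}
    (hy : y ∈ φ.target) {η : Form n p M} (h : coeff φ η y = 0) : η (φ.symm y) = 0 := by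
  let e : EuclideanSpace ℝ (Fin n) ≃ₗ[ℝ] TangentSpace (𝓡 n) (φ.symm y) :=
    ((mdifferentiable_of_mem hφ).symm.mfderiv (x := y) hy).toLinearEquiv
  let b : Module.Basis (Fin n) ℝ (TangentSpace (𝓡 n) (φ.symm y)) :=
    (EuclideanSpace.basisFun (Fin n) ℝ).toBasis.map e
  have hb : ∀ i, b i = coordVector φ y i := by
    intro i
    simp only [b, Module.Basis.map_apply, OrthonormalBasis.coe_toBasis,
      EuclideanSpace.basisFun_apply]
    rfl
  have hmono : ∀ s : Fin p ↪o Fin n, η (φ.symm y) (fun a => b (s a)) = 0 := by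
    intro s
    simp only [hb]
    exact congrFun (congrArg WithLp.ofLp h) s
  have h0 : (η (φ.symm y)).toAlternatingMap = 0 := by
    refine Module.Basis.ext_alternating b fun v hv => ?_
    have hs : StrictMono (v ∘ Tuple.sort v) :=
      (Tuple.monotone_sort v).strictMono_of_injective (hv.comp (Equiv.injective _))
    have h1 := hmono (OrderEmbedding.ofStrictMono _ hs)
    have h2 := (η (φ.symm y)).toAlternatingMap.map_perm (fun a => b (v a)) (Tuple.sort v)
    have h3 : (η (φ.symm y)).toAlternatingMap ((fun a => b (v a)) ∘ Tuple.sort v) = 0 := h1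
    rw [h3] at h2
    rw [AlternatingMap.zero_apply]
    exact (smul_eq_zero_iff_eq _).1 h2.symm
  ext v
  exact congrArg (fun g => g v) h0

namespace ChartPartition

variable (D : ChartPartition n M ι)

lemma localCoeff_apply_of_mem (i : ι) (η : Form n p M) {y : EuclideanSpace ℝ (Fin n)}
    (hy : y ∈ (D.chart i).target) :
    D.localCoeff i η y = D.pou i ((D.chart i).symm y) • coeff (D.chart i) η y := by
  rw [localCoeff, if_pos hy]
  rfl

lemma localCoeff_add (i : ι) (η θ : Form n p M) :
    D.localCoeff i (η + θ) = D.localCoeff i η + D.localCoeff i θ := by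
  ext1 y
  by_cases hy : y ∈ (D.chart i).target
  · simp [D.localCoeff_apply_of_mem i _ hy, coeff_add]
  · simp [localCoeff, hy]

lemma localCoeff_smul (i : ι) (c : ℝ) (η : Form n p M) :
    D.localCoeff i (c • η) = c • D.localCoeff i η := by
  ext1 y
  by_cases hy : y ∈ (D.chart i).target
  · simp [D.localCoeff_apply_of_mem i _ hy, coeff_smul, smul_comm c]
  · simp [localCoeff, hy]

lemma localCoeff_eq_zero (i : ι) (η : Form n p M) {y : EuclideanSpace ℝ (Fin n)}
    (hy : y ∉ D.chart i '' tsupport (D.pou i)) : D.localCoeff i η y = 0 := by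
  by_cases hy' : y ∈ (D.chart i).target
  · have h : (D.chart i).symm y ∉ tsupport (D.pou i) :=
      fun h => hy ⟨_, h, (D.chart i).right_inv hy'⟩
    rw [D.localCoeff_apply_of_mem i η hy', image_eq_zero_of_notMem_tsupport h, zero_smul]
  · simp [localCoeff, hy']

lemma eq_zero_of_localCoeff_eq_zero [IsManifold (𝓡 n) ∞ M] {η : Form n p M}
    (h : ∀ i, D.localCoeff i η = 0) : η = 0 := by
  funext x
  obtain ⟨i, hi⟩ : ∃ i, D.pou i x ≠ 0 := by
    by_contra! hx
    have := D.pou.sum_eq_one (Set.mem_univ x)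
    simp [hx] at this
  have hx : x ∈ (D.chart i).source := D.subordinate i (subset_tsupport _ hi)
  have hy := (D.chart i).map_source hx
  have h1 := congrFun (h i) (D.chart i x)
  rw [D.localCoeff_apply_of_mem i η hy, (D.chart i).left_inv hx, Pi.zero_apply,
    smul_eq_zero_iff_right hi] at h1
  have h2 := eq_zero_of_coeff_eq_zero (D.chart_mem i) hy h1
  rwa [(D.chart i).left_inv hx] at h2

variable [CompactSpace M]

/-- The compact set, inside the image of the `i`-th chart, that carries the local
coefficients. -/
lemma isCompact_image (i : ι) : IsCompact (D.chart i '' tsupport (D.pou i)) :=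
  (isClosed_tsupport _).isCompact.image_of_continuousOn
    ((D.chart i).continuousOn.mono (D.subordinate i))

lemma hasCompactSupport_localCoeff (i : ι) (η : Form n p M) :
    HasCompactSupport (D.localCoeff i η) :=
  HasCompactSupport.intro (D.isCompact_image i) fun _ hy => D.localCoeff_eq_zero i η hy

lemma contDiff_localCoeff [IsManifold (𝓡 n) ∞ M] (i : ι) {k : ℕ} {η : Form n p M}
    (hη : IsCk k η) : ContDiff ℝ (k : ℕ∞) (D.localCoeff i η) := by
  rw [contDiff_iff_contDiffAt]
  intro y
  by_cases hy : y ∈ (D.chart i).target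
  · have hn : (D.chart i).target ∈ nhds y := (D.chart i).open_target.mem_nhds hy
    have h1 : ContDiffOn ℝ (k : ℕ∞) (fun y => D.pou i ((D.chart i).symm y))
        (D.chart i).target := by
      have h : ContMDiffOn (𝓡 n) 𝓘(ℝ, ℝ) ∞ (fun y => D.pou i ((D.chart i).symm y))
          (D.chart i).target :=
        (D.pou i).contMDiff.comp_contMDiffOn
          (contMDiffOn_symm_of_mem_maximalAtlas (D.chart_mem i))
      exact h.contDiffOn.of_le (by exact_mod_cast le_top)
    have h2 := (h1.smul (hη _ (D.chart_mem i))).contDiffAt hn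
    refine h2.congr_of_eventuallyEq ?_
    filter_upwards [hn] with z hz
    exact D.localCoeff_apply_of_mem i η hz
  · have hn : (D.chart i '' tsupport (D.pou i))ᶜ ∈ nhds y := by
      refine (D.isCompact_image i).isClosed.isOpen_compl.mem_nhds ?_
      rintro ⟨x, hx, rfl⟩
      exact hy ((D.chart i).map_source (D.subordinate i hx))
    refine (contDiffAt_const (c := (0 : EuclideanSpace ℝ (Fin p ↪o Fin n)))).congr_of_eventuallyEq ?_
    filter_upwards [hn] with z hz
    exact D.localCoeff_eq_zero i η hz

end ChartPartition

variable (n p M) in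
/-- The vector space of `p`-forms of class `C^k` on `M`. -/
def ckSubmodule (k : ℕ) : Submodule ℝ (Form n p M) where
  carrier := {η | IsCk k η}
  add_mem' := fun ha hb φ hφ => (ha φ hφ).add (hb φ hφ)
  zero_mem' := fun _ _ => contDiffOn_const (c := 0)
  smul_mem' := fun c _ ha φ hφ => (ha φ hφ).const_smul c

variable (p) in
/-- The space `C^k(M, Λ^p)` of `p`-forms of class `C^k` on `M`, with the norm that is defined
through the charts and the partition of unity `D`. -/
def CkForms (_D : ChartPartition n M ι) (k : ℕ) : Type _ := ckSubmodule n p M k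

namespace CkForms

variable (D : ChartPartition n M ι) (k : ℕ)

instance : AddCommGroup (CkForms p D k) := inferInstanceAs (AddCommGroup (ckSubmodule n p M k))

instance : Module ℝ (CkForms p D k) := inferInstanceAs (Module ℝ (ckSubmodule n p M k))

variable {D k} in
/-- A form of class `C^k` as an element of the space `C^k(M, Λ^p)`. -/
def mk (η : Form n p M) (hη : IsCk k η) : CkForms p D k := ⟨η, hη⟩

variable {D k} in
/-- The form underlying an element of `C^k(M, Λ^p)`. -/
def form (η : CkForms p D k) : Form n p M := η.1

lemma isCk (η : CkForms p D k) : IsCk k η.form := η.2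

variable [Fintype ι]

/-- `‖η‖ = ∑ᵢ ‖φᵢ_* (λᵢ η)‖_{C^k}`. -/
instance : Norm (CkForms p D k) := ⟨fun η => ∑ i, ckNorm k (D.localCoeff i η.form)⟩

lemma norm_def (η : CkForms p D k) : ‖η‖ = ∑ i, ckNorm k (D.localCoeff i η.form) := rfl

variable [CompactSpace M] [IsManifold (𝓡 n) ∞ M]

lemma normedSpaceCore : NormedSpace.Core ℝ (CkForms p D k) where
  norm_nonneg η := Finset.sum_nonneg fun i _ => ckNorm_nonneg k _
  norm_smul c η := by
    simp only [norm_def, Finset.mul_sum, Real.norm_eq_abs]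
    refine Finset.sum_congr rfl fun i _ => ?_
    rw [← ckNorm_smul k c (D.contDiff_localCoeff i η.isCk), ← D.localCoeff_smul]
    rfl
  norm_triangle η θ := by
    simp only [norm_def, ← Finset.sum_add_distrib]
    refine Finset.sum_le_sum fun i _ => ?_
    refine le_trans (le_of_eq ?_) (ckNorm_add_le k (D.contDiff_localCoeff i η.isCk)
      (D.contDiff_localCoeff i θ.isCk) (D.hasCompactSupport_localCoeff i η.form)
      (D.hasCompactSupport_localCoeff i θ.form))
    rw [← D.localCoeff_add]
    rfl
  norm_eq_zero_iff η := by
    constructor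
    · intro h
      rw [norm_def, Finset.sum_eq_zero_iff_of_nonneg fun i _ => ckNorm_nonneg k _] at h
      refine Subtype.ext (D.eq_zero_of_localCoeff_eq_zero fun i => ?_)
      exact eq_zero_of_ckNorm_eq_zero k (D.contDiff_localCoeff i η.isCk)
        (D.hasCompactSupport_localCoeff i η.form) (h i (Finset.mem_univ i))
    · rintro rfl
      rw [norm_def]
      refine Finset.sum_eq_zero fun i _ => ?_
      have h : D.localCoeff i (0 : CkForms p D k).form =
          (0 : ℝ) • D.localCoeff i (0 : Form n p M) := by
        rw [← D.localCoeff_smul, zero_smul]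
        rfl
      have h0 : IsCk k (0 : Form n p M) := (0 : CkForms p D k).isCk
      rw [h, ckNorm_smul k 0 (D.contDiff_localCoeff i h0)]
      simp

instance : NormedAddCommGroup (CkForms p D k) := .ofCore (normedSpaceCore D k)

instance : NormedSpace ℝ (CkForms p D k) := .ofCore (normedSpaceCore D k)

end CkForms
end Forms
end FormFamily
end

/-!
The `C^k` norm is equivalent to the supremum of the evaluation functionals
`η ↦ ∂^α (φ_{i*} (λᵢ η)) (y)` with `|α| ≤ k`. Continuity and differentiability of a curve in
`C^k(M, Λ^p)` can therefore be tested on these functionals, uniformly in `i`, `α` and `y`; for the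
derivative the uniformity comes from the mean value inequality. For a smooth family these
functionals are smooth in `(t, y)`, and `∂_v` of a smooth family is again a smooth family, so an
induction on the order gives smoothness into `C^k`.

Conversely, evaluation at `y` with `α = 0` is of class `C^m` in `y`, as a functional on
`C^{m+1}(M, Λ^p)` in the operator norm. Applying it to a smooth curve in `C^{m+1}` shows that the
local coefficients are jointly `C^m` in `(t, y)` for every `m`.
-/

noncomputable section
namespace FormFamily

section Norming

variable {F V J T : Type*} [NormedAddCommGroup F] [NormedSpace ℝ F] [NormedAddCommGroup V]
  [NormedSpace ℝ V]

/-- A family of contractions `δ j : F → V` is norming with constant `C` if the norm of `F` is at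
most `C` times the supremum of the norms of the components `δ j`. This is stated without a supremum,
so that it makes sense before the components are known to be bounded uniformly. -/
structure IsNorming (C : ℝ) (δ : J → F →L[ℝ] V) : Prop where
  pos : 0 < C
  norm_le_one : ∀ j, ‖δ j‖ ≤ 1
  norm_le : ∀ f c, 0 ≤ c → (∀ j, ‖δ j f‖ ≤ c) → ‖f‖ ≤ C * c

lemma isNorming_apply (X V : Type*) [NormedAddCommGroup X] [NormedSpace ℝ X]
    [NormedAddCommGroup V] [NormedSpace ℝ V] :
    IsNorming 1 fun x : Metric.closedBall (0 : X) 1 =>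
      ContinuousLinearMap.apply ℝ V (x : X) where
  pos := one_pos
  norm_le_one x := ContinuousLinearMap.opNorm_le_bound _ zero_le_one fun A => by
    rw [one_mul]
    exact A.unit_le_opNorm x (mem_closedBall_zero_iff.1 x.2)
  norm_le A c hc h := by
    rw [one_mul]
    exact A.opNorm_le_of_unit_norm hc fun x hx => h ⟨x, mem_closedBall_zero_iff.2 hx.le⟩

namespace IsNorming

variable {C : ℝ} {δ : J → F →L[ℝ] V} (hδ : IsNorming C δ)
include hδ

lemma continuousAt [TopologicalSpace T] {ζ : T → F} {t₀ : T}
    (h : ∀ ε > 0, ∀ᶠ t in nhds t₀, ∀ j, ‖δ j (ζ t) - δ j (ζ t₀)‖ ≤ ε) : ContinuousAt ζ t₀ := by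
  rw [ContinuousAt, tendsto_iff_norm_sub_tendsto_zero, ← Asymptotics.isLittleO_one_iff ℝ,
    Asymptotics.isLittleO_iff]
  intro ε hε
  filter_upwards [h (ε / C) (div_pos hε hδ.pos)] with t ht
  rw [norm_norm, norm_one, mul_one]
  calc ‖ζ t - ζ t₀‖ ≤ C * (ε / C) :=
        hδ.norm_le _ _ (div_pos hε hδ.pos).le fun j => by simpa only [map_sub] using ht j
    _ = ε := mul_div_cancel₀ ε hδ.pos.ne'

variable [NormedAddCommGroup T] [NormedSpace ℝ T] {ζ : T → F} {ζ' : T → T →L[ℝ] F}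

lemma norm_image_sub_sub_le (h : ∀ j t, HasFDerivAt (fun s => δ j (ζ s)) (δ j ∘L ζ' t) t)
    {s : Set T} (hs : Convex ℝ s) {φ : T →L[ℝ] F} {ε : ℝ} (hε : ∀ t ∈ s, ‖ζ' t - φ‖ ≤ ε) {x y : T}
    (hx : x ∈ s) (hy : y ∈ s) : ‖ζ y - ζ x - φ (y - x)‖ ≤ C * (ε * ‖y - x‖) := by
  have hε₀ : 0 ≤ ε := (norm_nonneg _).trans (hε x hx)
  refine hδ.norm_le _ _ (by positivity) fun j => ?_
  rw [map_sub, map_sub]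
  refine hs.norm_image_sub_le_of_norm_hasFDerivWithin_le' (f := fun s => δ j (ζ s))
    (φ := δ j ∘L φ) (fun t _ => (h j t).hasFDerivWithinAt) (fun t ht => ?_) hx hy
  rw [← ContinuousLinearMap.comp_sub]
  calc ‖δ j ∘L (ζ' t - φ)‖ ≤ ‖δ j‖ * ‖ζ' t - φ‖ := ContinuousLinearMap.opNorm_comp_le _ _
    _ ≤ 1 * ε := mul_le_mul (hδ.norm_le_one j) (hε t ht) (norm_nonneg _) zero_le_one
    _ = ε := one_mul ε

lemma continuous_of_norm_deriv_le (h : ∀ j t, HasFDerivAt (fun s => δ j (ζ s)) (δ j ∘L ζ' t) t)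
    {B : ℝ} (hB : ∀ t, ‖ζ' t‖ ≤ B) : Continuous ζ := by
  refine continuous_iff_continuousAt.2 fun x =>
    continuousAt_of_locally_lipschitz one_pos (C * B) fun y _ => ?_
  have hxy := hδ.norm_image_sub_sub_le h convex_univ (φ := 0) (fun t _ => by simpa using hB t)
    (Set.mem_univ x) (Set.mem_univ y)
  rw [dist_eq_norm, dist_eq_norm, mul_assoc]
  simpa using hxy

/-- Differentiability can be tested on the components, provided that the candidate for the
derivative is continuous: the mean value inequality is then uniform in the component. -/
lemma hasFDerivAt (h : ∀ j t, HasFDerivAt (fun s => δ j (ζ s)) (δ j ∘L ζ' t) t) {t₀ : T}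
    (hc : ContinuousAt ζ' t₀) : HasFDerivAt ζ (ζ' t₀) t₀ := by
  rw [hasFDerivAt_iff_isLittleO, Asymptotics.isLittleO_iff]
  intro ε hε
  obtain ⟨r, hr, hball⟩ := Metric.continuousAt_iff.1 hc (ε / C) (div_pos hε hδ.pos)
  filter_upwards [Metric.ball_mem_nhds t₀ hr] with t ht
  calc ‖ζ t - ζ t₀ - ζ' t₀ (t - t₀)‖ ≤ C * (ε / C * ‖t - t₀‖) :=
        hδ.norm_image_sub_sub_le h (convex_ball t₀ r)
          (fun s hs => dist_eq_norm (ζ' s) (ζ' t₀) ▸ (hball hs).le) (Metric.mem_ball_self hr) ht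
    _ = ε * ‖t - t₀‖ := by rw [← mul_assoc, mul_div_cancel₀ ε hδ.pos.ne']

end IsNorming

end Norming

lemma fderiv_fderiv_apply_comm {X V : Type*} [NormedAddCommGroup X] [NormedSpace ℝ X]
    [NormedAddCommGroup V] [NormedSpace ℝ V] {f : X → V} (hf : ContDiff ℝ 2 f) (x u v : X) :
    fderiv ℝ (fun z => fderiv ℝ f z v) x u = fderiv ℝ (fun z => fderiv ℝ f z u) x v := by
  have hd : DifferentiableAt ℝ (fderiv ℝ f) x :=
    (hf.fderiv_right (m := 1) (by norm_num)).differentiable one_ne_zero x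
  simpa [fderiv_clm_apply hd (differentiableAt_const _)] using
    (hf.contDiffAt.isSymmSndFDerivAt (by simp)) u v

section PartialDerivatives

variable {n : ℕ} {V : Type*} [NormedAddCommGroup V] [NormedSpace ℝ V]
  {f : EuclideanSpace ℝ (Fin n) → V}

lemma fderiv_eq_sum_pderiv (f : EuclideanSpace ℝ (Fin n) → V) (y : EuclideanSpace ℝ (Fin n)) :
    fderiv ℝ f y = ∑ j, (EuclideanSpace.proj j).smulRight (pderiv j f y) := by
  ext w
  conv_lhs => rw [← (EuclideanSpace.basisFun (Fin n) ℝ).sum_repr w]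
  simp [pderiv]

lemma pderiv_comm (i j : Fin n) (hf : ContDiff ℝ 2 f) :
    pderiv i (pderiv j f) = pderiv j (pderiv i f) :=
  funext fun _ => fderiv_fderiv_apply_comm hf _ _ _

lemma pderiv_iterate_comm (i j : Fin n) (a : ℕ) (hf : ContDiff ℝ ((a + 1 : ℕ) : ℕ∞) f) :
    pderiv j ((pderiv i)^[a] f) = (pderiv i)^[a] (pderiv j f) := by
  induction a generalizing f with
  | zero => rfl
  | succ a ih =>
    have hf₂ : ContDiff ℝ 2 f := hf.of_le <| WithTop.coe_le_coe.2 <|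
      show ((2 : ℕ) : ℕ∞) ≤ ((a + 1 + 1 : ℕ) : ℕ∞) by norm_cast; omega
    rw [Function.iterate_succ_apply, Function.iterate_succ_apply, ih (contDiff_pderiv i hf),
      pderiv_comm j i hf₂]

lemma pderivList_congr {α β : Fin n → ℕ} {L : List (Fin n)} (h : ∀ i ∈ L, α i = β i)
    (f : EuclideanSpace ℝ (Fin n) → V) : pderivList α L f = pderivList β L f :=
  List.foldr_ext _ _ _ fun i hi g => by rw [h i hi]

lemma pderiv_pderivList (α : Fin n → ℕ) (j : Fin n) {L : List (Fin n)} (hL : L.Nodup) (hj : j ∈ L)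
    (hf : ContDiff ℝ (((L.map α).sum + 1 : ℕ) : ℕ∞) f) :
    pderiv j (pderivList α L f) = pderivList (α + Pi.single j 1) L f := by
  induction L with
  | nil => simp at hj
  | cons i L ih =>
    change pderiv j ((pderiv i)^[α i] (pderivList α L f)) =
      (pderiv i)^[(α + Pi.single j 1 : Fin n → ℕ) i] (pderivList (α + Pi.single j 1) L f)
    obtain ⟨hiL, hL⟩ := List.nodup_cons.1 hL
    obtain rfl | hij := eq_or_ne i j
    · have hL_eq : ∀ k ∈ L, α k = (α + Pi.single i 1 : Fin n → ℕ) k := fun k hk => by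
        simp [ne_of_mem_of_not_mem hk hiL]
      rw [← pderivList_congr hL_eq, ← Function.iterate_succ_apply' (pderiv i)]
      simp
    · have hfi : ContDiff ℝ ((α i + 1 + (L.map α).sum : ℕ) : ℕ∞) f :=
        hf.of_le (by norm_cast; simp only [List.map_cons, List.sum_cons]; omega)
      rw [pderiv_iterate_comm i j (α i) (contDiff_pderivList α L _ hfi),
        ih hL ((List.mem_cons.1 hj).resolve_left hij.symm) (hf.of_le (by norm_cast; simp))]
      simp [hij]

lemma pderiv_mpderiv (α : Fin n → ℕ) (j : Fin n)
    (hf : ContDiff ℝ ((∑ i, α i + 1 : ℕ) : ℕ∞) f) :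
    pderiv j (mpderiv α f) = mpderiv (α + Pi.single j 1) f :=
  pderiv_pderivList α j (List.nodup_finRange n) (List.mem_finRange j)
    (by rwa [sum_map_finRange])

lemma mpderiv_induction
    {P : ((EuclideanSpace ℝ (Fin n) → V) → EuclideanSpace ℝ (Fin n) → V) → Prop}
    (id : P id) (pderiv_comp : ∀ i A, P A → P (pderiv i ∘ A)) (α : Fin n → ℕ) : P (mpderiv α) := by
  have iterate : ∀ i a A, P A → P ((pderiv i)^[a] ∘ A) := fun i a A hA => by
    induction a with
    | zero => exact hA
    | succ a ih =>
      rw [Function.iterate_succ']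
      exact pderiv_comp i _ ih
  have list : ∀ L, P (pderivList α L) := fun L => by
    induction L with
    | nil => exact id
    | cons i L ih => exact iterate i (α i) _ ih
  exact list _

lemma mpderiv_zero (f : EuclideanSpace ℝ (Fin n) → V) : mpderiv 0 f = f :=
  List.foldr_fixed' (fun _ => rfl) _

lemma contDiff_mpderiv (α : Fin n → ℕ) (m : ℕ) (hf : ContDiff ℝ ((m + ∑ i, α i : ℕ) : ℕ∞) f) :
    ContDiff ℝ (m : ℕ∞) (mpderiv α f) :=
  contDiff_pderivList α _ m (by rwa [sum_map_finRange])

lemma hasFDerivAt_mpderiv (α : Fin n → ℕ) (hf : ContDiff ℝ ((∑ i, α i + 1 : ℕ) : ℕ∞) f)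
    (y : EuclideanSpace ℝ (Fin n)) :
    HasFDerivAt (mpderiv α f)
      (∑ j, (EuclideanSpace.proj (𝕜 := ℝ) j).smulRight (mpderiv (α + Pi.single j 1) f y)) y := by
  have hd : Differentiable ℝ (mpderiv α f) :=
    (contDiff_mpderiv α 1 (by rwa [add_comm])).differentiable (by simp)
  simpa only [fderiv_eq_sum_pderiv, pderiv_mpderiv α _ hf] using (hd y).hasFDerivAt

lemma mpderiv_eq_zero_of_notMem {K : Set (EuclideanSpace ℝ (Fin n))} (hK : IsClosed K)
    (hf : ∀ y ∉ K, f y = 0) (α : Fin n → ℕ) : ∀ y ∉ K, mpderiv α f y = 0 := by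
  refine mpderiv_induction (P := fun A => ∀ y ∉ K, A f y = 0) hf (fun i A hA y hy => ?_) α
  have hzero : A f =ᶠ[nhds y] fun _ => 0 := by
    filter_upwards [hK.isOpen_compl.mem_nhds hy] with z hz using hA z hz
  simp [pderiv, hzero.fderiv_eq]

lemma iSup_norm_mpderiv_nonneg (α : Fin n → ℕ) (f : EuclideanSpace ℝ (Fin n) → V) :
    0 ≤ ⨆ y, ‖mpderiv α f y‖ := Real.iSup_nonneg fun _ => norm_nonneg _

lemma norm_mpderiv_le_ckNorm {k : ℕ} {α : Fin n → ℕ} (hα : ∑ i, α i ≤ k)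
    (hf : ContDiff ℝ (k : ℕ∞) f) (hc : HasCompactSupport f) (y : EuclideanSpace ℝ (Fin n)) :
    ‖mpderiv α f y‖ ≤ ckNorm k f :=
  calc ‖mpderiv α f y‖ ≤ ⨆ y, ‖mpderiv α f y‖ :=
        le_ciSup (bddAbove_mpderiv (hf.of_le (by exact_mod_cast hα)) hc) y
    _ ≤ ∑ β ∈ Finset.Nat.antidiagonalTuple n (∑ i, α i), ⨆ y, ‖mpderiv β f y‖ :=
        Finset.single_le_sum (f := fun β => ⨆ y, ‖mpderiv β f y‖)
          (fun β _ => iSup_norm_mpderiv_nonneg β f) (Finset.Nat.mem_antidiagonalTuple.2 rfl)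
    _ ≤ ckNorm k f :=
        Finset.single_le_sum
          (f := fun j => ∑ β ∈ Finset.Nat.antidiagonalTuple n j, ⨆ y, ‖mpderiv β f y‖)
          (fun j _ => Finset.sum_nonneg fun β _ => iSup_norm_mpderiv_nonneg β f)
          (Finset.mem_range_succ_iff.2 hα)

lemma ckNorm_le {k : ℕ} {c : ℝ}
    (h : ∀ α : Fin n → ℕ, ∑ i, α i ≤ k → ∀ y, ‖mpderiv α f y‖ ≤ c) :
    ckNorm k f ≤ (∑ j ∈ Finset.range (k + 1), (Finset.Nat.antidiagonalTuple n j).card : ℕ) * c := by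
  rw [ckNorm, Nat.cast_sum, Finset.sum_mul]
  refine Finset.sum_le_sum fun j hj => (Finset.sum_le_card_nsmul _ _ c fun α hα => ?_).trans_eq
    (nsmul_eq_mul _ _)
  refine ciSup_le (h α ?_)
  rw [Finset.Nat.mem_antidiagonalTuple.1 hα]
  exact Finset.mem_range_succ_iff.1 hj

end PartialDerivatives

lemma eventually_forall_norm_sub_lt {T E V : Type*} [TopologicalSpace T] [TopologicalSpace E]
    [NormedAddCommGroup V] {g : T → E → V} (hg : Continuous (Function.uncurry g))
    {K : Set E} (hK : IsCompact K) (hz : ∀ t, ∀ y ∉ K, g t y = 0) (t₀ : T) {ε : ℝ} (hε : 0 < ε) :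
    ∀ᶠ t in nhds t₀, ∀ y, ‖g t y - g t₀ y‖ < ε := by
  have hKε : ∀ᶠ t in nhds t₀, ∀ y ∈ K, ‖g t y - g t₀ y‖ < ε := by
    refine hK.eventually_forall_of_forall_eventually fun y _ => ?_
    have hdiff : Continuous fun q : T × E => ‖g q.1 q.2 - g t₀ q.2‖ :=
      (hg.sub (hg.comp (continuous_const.prodMk continuous_snd))).norm
    exact hdiff.continuousAt.eventually_lt continuousAt_const (by simpa using hε)
  filter_upwards [hKε] with t ht y
  by_cases hy : y ∈ K
  · exact ht y hy
  · simpa [hz _ y hy] using hε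

section ParameterDerivatives

variable {T E V : Type*} [NormedAddCommGroup T] [NormedSpace ℝ T] [NormedAddCommGroup V]
  [NormedSpace ℝ V]

/-- The derivative `∂_v g` of a family of functions `g t` in the direction `v` of the parameter. -/
def paramDeriv (v : T) (g : T → E → V) (t : T) (y : E) : V := fderiv ℝ (fun s => g s y) t v

variable [NormedAddCommGroup E] [NormedSpace ℝ E] {g : T → E → V}

lemma paramDeriv_eq_fderiv_uncurry {t : T} {y : E}
    (hg : DifferentiableAt ℝ (Function.uncurry g) (t, y)) (v : T) :
    paramDeriv v g t y = fderiv ℝ (Function.uncurry g) (t, y) (v, 0) := by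
  have h := hg.hasFDerivAt.comp (f := fun s => (s, y)) t (hasFDerivAt_prodMk_left t y)
  exact congrArg (· v) h.fderiv

lemma fderiv_apply_eq_fderiv_uncurry (hg : Differentiable ℝ (Function.uncurry g)) (t : T)
    (y w : E) : fderiv ℝ (g t) y w = fderiv ℝ (Function.uncurry g) (t, y) (0, w) := by
  have h := (hg (t, y)).hasFDerivAt.comp y (hasFDerivAt_prodMk_right t y)
  exact congrArg (· w) h.fderiv

lemma contDiff_fderiv_uncurry_apply (hg : ContDiff ℝ ∞ (Function.uncurry g)) (q : T × E) :
    ContDiff ℝ ∞ fun p => fderiv ℝ (Function.uncurry g) p q :=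
  (hg.fderiv_right (m := ∞) (by simp)).clm_apply contDiff_const

lemma contDiff_paramDeriv (v : T) (hg : ContDiff ℝ ∞ (Function.uncurry g)) :
    ContDiff ℝ ∞ (Function.uncurry (paramDeriv v g)) := by
  convert contDiff_fderiv_uncurry_apply hg (v, 0) using 1
  exact funext fun q => paramDeriv_eq_fderiv_uncurry (hg.differentiable (by simp) q) v

end ParameterDerivatives

section ParameterPartialDerivatives

variable {n : ℕ} {T V : Type*} [NormedAddCommGroup T] [NormedSpace ℝ T] [NormedAddCommGroup V]
  [NormedSpace ℝ V] {g : T → EuclideanSpace ℝ (Fin n) → V}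

lemma contDiff_pderiv_param (i : Fin n) (hg : ContDiff ℝ ∞ (Function.uncurry g)) :
    ContDiff ℝ ∞ (Function.uncurry fun t => pderiv i (g t)) := by
  convert contDiff_fderiv_uncurry_apply hg (0, EuclideanSpace.single i 1) using 1
  exact funext fun q => fderiv_apply_eq_fderiv_uncurry (hg.differentiable (by simp)) q.1 q.2 _

lemma pderiv_paramDeriv (i : Fin n) (v : T) (hg : ContDiff ℝ ∞ (Function.uncurry g)) (t : T) :
    pderiv i (paramDeriv v g t) = paramDeriv v (fun s => pderiv i (g s)) t := by
  have hd : Differentiable ℝ (Function.uncurry g) := hg.differentiable (by simp)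
  have hpderiv : (Function.uncurry fun s => pderiv i (g s)) =
      fun q => fderiv ℝ (Function.uncurry g) q (0, EuclideanSpace.single i 1) :=
    funext fun q => fderiv_apply_eq_fderiv_uncurry hd q.1 q.2 _
  have hparam : Function.uncurry (paramDeriv v g) =
      fun q => fderiv ℝ (Function.uncurry g) q (v, 0) :=
    funext fun q => paramDeriv_eq_fderiv_uncurry (hd q) v
  ext1 y
  rw [pderiv, fderiv_apply_eq_fderiv_uncurry ((contDiff_paramDeriv v hg).differentiable (by simp)),
    paramDeriv_eq_fderiv_uncurry ((contDiff_pderiv_param i hg).differentiable (by simp) _),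
    hpderiv, hparam]
  exact fderiv_fderiv_apply_comm (hg.of_le (WithTop.coe_le_coe.2 le_top)) _ _ _

lemma contDiff_mpderiv_param (α : Fin n → ℕ) (hg : ContDiff ℝ ∞ (Function.uncurry g)) :
    ContDiff ℝ ∞ (Function.uncurry fun t => mpderiv α (g t)) :=
  mpderiv_induction (P := fun A => ContDiff ℝ ∞ (Function.uncurry fun t => A (g t))) hg
    (fun i _ hA => contDiff_pderiv_param i hA) α

lemma mpderiv_paramDeriv (α : Fin n → ℕ) (v : T) (hg : ContDiff ℝ ∞ (Function.uncurry g)) (t : T) :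
    mpderiv α (paramDeriv v g t) = paramDeriv v (fun s => mpderiv α (g s)) t := by
  refine (mpderiv_induction (P := fun A => ContDiff ℝ ∞ (Function.uncurry fun s => A (g s)) ∧
    A (paramDeriv v g t) = paramDeriv v (fun s => A (g s)) t) ⟨hg, rfl⟩ (fun i A hA => ?_) α).2
  refine ⟨contDiff_pderiv_param i hA.1, ?_⟩
  rw [Function.comp_apply, hA.2, pderiv_paramDeriv i v hA.1]
  rfl

end ParameterPartialDerivatives

lemma alternatingMap_ext_strictMono {R N N' : Type*} [CommRing R] [AddCommGroup N] [Module R N]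
    [AddCommGroup N'] [Module R N'] {I : Type*} [LinearOrder I] {p : ℕ} (b : Module.Basis I R N)
    {ξ ξ' : N [⋀^Fin p]→ₗ[R] N'}
    (h : ∀ s : Fin p ↪o I, ξ (fun a => b (s a)) = ξ' fun a => b (s a)) : ξ = ξ' := by
  refine Module.Basis.ext_alternating b fun v hv => ?_
  have hs : StrictMono (v ∘ Tuple.sort v) :=
    (Tuple.monotone_sort v).strictMono_of_injective (hv.comp (Equiv.injective _))
  have hsort : ξ ((fun a => b (v a)) ∘ Tuple.sort v) = ξ' ((fun a => b (v a)) ∘ Tuple.sort v) :=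
    h (OrderEmbedding.ofStrictMono _ hs)
  rw [AlternatingMap.map_perm, AlternatingMap.map_perm] at hsort
  exact smul_left_cancel _ hsort

section Alternating

variable {n p : ℕ} {E : Type*} [NormedAddCommGroup E] [NormedSpace ℝ E]

/-- The coefficients of an alternating form with respect to a family of vectors, indexed by
increasing tuples as in `coeff`. -/
def altCoeff (e : Fin n → E) : (E [⋀^Fin p]→L[ℝ] ℝ) →L[ℝ] EuclideanSpace ℝ (Fin p ↪o Fin n) :=
  (EuclideanSpace.equiv (Fin p ↪o Fin n) ℝ).symm.toContinuousLinearMap.comp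
    (ContinuousLinearMap.pi fun s => ContinuousAlternatingMap.apply ℝ E ℝ fun a => e (s a))

lemma altCoeff_injective (b : Module.Basis (Fin n) ℝ E) :
    Function.Injective (altCoeff (p := p) b) := fun _ _ h =>
  ContinuousAlternatingMap.toAlternatingMap_injective <| alternatingMap_ext_strictMono b fun s =>
    congrFun (congrArg WithLp.ofLp h) s

variable {X : Type*} [NormedAddCommGroup X] [NormedSpace ℝ X] {k : WithTop ℕ∞} {x : X}
  {ξ : X → E [⋀^Fin p]→L[ℝ] ℝ}

lemma contDiffAt_altCoeff_iff (b : Module.Basis (Fin n) ℝ E) :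
    ContDiffAt ℝ k (fun z => altCoeff b (ξ z)) x ↔ ContDiffAt ℝ k ξ x := by
  have hb : (altCoeff (p := p) b).HasLeftInverse :=
    .of_injective_of_finiteDimensional (altCoeff_injective b)
  refine ⟨fun h => ?_, (altCoeff b).contDiff.contDiffAt.comp x⟩
  have hcomp := hb.leftInverse.contDiff.contDiffAt.comp x h
  simpa [Function.comp_def, hb.leftInverse_leftInverse _] using hcomp

lemma contDiffAt_alternatingMap_apply {u : X → Fin p → E} (hξ : ContDiffAt ℝ k ξ x)
    (hu : ∀ a, ContDiffAt ℝ k (fun z => u z a) x) : ContDiffAt ℝ k (fun z => ξ z (u z)) x := by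
  let A : (E [⋀^Fin p]→L[ℝ] ℝ) →L[ℝ] ContinuousMultilinearMap ℝ (fun _ : Fin p => E) ℝ :=
    ContinuousAlternatingMap.toContinuousMultilinearMapCLM ℝ
  have hA : ContDiff ℝ k fun r : (E [⋀^Fin p]→L[ℝ] ℝ) × (Fin p → E) => A r.1 r.2 :=
    (A.analyticOnNhd_uncurry_of_multilinear (s := Set.univ)).contDiff
  exact hA.contDiffAt.comp x (hξ.prodMk (contDiffAt_pi.2 hu))

lemma contDiffAt_compContinuousLinearMap {E' : Type*} [NormedAddCommGroup E'] [NormedSpace ℝ E']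
    (b : Module.Basis (Fin n) ℝ E') {B : X → E' →L[ℝ] E} (hξ : ContDiffAt ℝ k ξ x)
    (hB : ContDiffAt ℝ k B x) :
    ContDiffAt ℝ k (fun z => (ξ z).compContinuousLinearMap (B z)) x := by
  rw [← contDiffAt_altCoeff_iff b, contDiffAt_euclidean]
  exact fun s => contDiffAt_alternatingMap_apply hξ fun a => hB.clm_apply contDiffAt_const

end Alternating

section Forms

variable {n p : ℕ} {M : Type*} [TopologicalSpace M] [ChartedSpace (EuclideanSpace ℝ (Fin n)) M]

/-- The value of a form at a point, with the tangent space identified with the model space. -/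
def Form.value (θ : Form n p M) (x : M) : EuclideanSpace ℝ (Fin n) [⋀^Fin p]→L[ℝ] ℝ := θ x

/-- The derivative of the inverse `φ⁻¹` of a chart, with the tangent space of `M` identified with
the model space. Its columns are the coordinate vector fields `coordVector φ y i`. -/
def coordDeriv (φ : OpenPartialHomeomorph M (EuclideanSpace ℝ (Fin n)))
    (y : EuclideanSpace ℝ (Fin n)) : EuclideanSpace ℝ (Fin n) →L[ℝ] EuclideanSpace ℝ (Fin n) :=
  mfderiv (𝓡 n) (𝓡 n) φ.symm y

/-- The coordinate expression `(φ⁻¹)^* θ` of a form in a chart `φ`. Only meaningful on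
`φ.target`. -/
def chartPullback (φ : OpenPartialHomeomorph M (EuclideanSpace ℝ (Fin n))) (θ : Form n p M)
    (y : EuclideanSpace ℝ (Fin n)) : EuclideanSpace ℝ (Fin n) [⋀^Fin p]→L[ℝ] ℝ :=
  (θ.value (φ.symm y)).compContinuousLinearMap (coordDeriv φ y)

variable {φ ψ : OpenPartialHomeomorph M (EuclideanSpace ℝ (Fin n))}

lemma coeff_eq_altCoeff (φ : OpenPartialHomeomorph M (EuclideanSpace ℝ (Fin n)))
    (θ : Form n p M) (y : EuclideanSpace ℝ (Fin n)) :
    coeff φ θ y = altCoeff (EuclideanSpace.basisFun (Fin n) ℝ).toBasis (chartPullback φ θ y) := by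
  simp only [OrthonormalBasis.coe_toBasis, EuclideanSpace.basisFun_apply, altCoeff, coeff,
    coordVector]
  rfl

lemma contDiffAt_coeff_iff {X : Type*} [NormedAddCommGroup X] [NormedSpace ℝ X] {k : WithTop ℕ∞}
    {θ : X → Form n p M} {y : X → EuclideanSpace ℝ (Fin n)} {x : X} :
    ContDiffAt ℝ k (fun z => coeff φ (θ z) (y z)) x ↔
      ContDiffAt ℝ k (fun z => chartPullback φ (θ z) (y z)) x := by
  simp only [coeff_eq_altCoeff, contDiffAt_altCoeff_iff]

section ChangeOfCoordinates

lemma contDiffAt_transition (hφ : φ ∈ IsManifold.maximalAtlas (𝓡 n) ∞ M)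
    (hψ : ψ ∈ IsManifold.maximalAtlas (𝓡 n) ∞ M) {y : EuclideanSpace ℝ (Fin n)}
    (hy : y ∈ (φ.symm.trans ψ).source) : ContDiffAt ℝ ∞ (φ.symm.trans ψ) y := by
  have h : ContMDiffOn (𝓡 n) (𝓡 n) ∞ (φ.symm.trans ψ) (φ.symm.trans ψ).source :=
    (contMDiffOn_of_mem_maximalAtlas hψ).comp
      ((contMDiffOn_symm_of_mem_maximalAtlas hφ).mono fun _ hz => hz.1) fun _ hz => hz.2
  exact h.contDiffOn.contDiffAt ((φ.symm.trans ψ).open_source.mem_nhds hy)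

variable [IsManifold (𝓡 n) ∞ M]

lemma coordDeriv_eq_comp_fderiv (hφ : φ ∈ IsManifold.maximalAtlas (𝓡 n) ∞ M)
    (hψ : ψ ∈ IsManifold.maximalAtlas (𝓡 n) ∞ M) {y : EuclideanSpace ℝ (Fin n)}
    (hy : y ∈ (φ.symm.trans ψ).source) :
    coordDeriv φ y = coordDeriv ψ (φ.symm.trans ψ y) ∘L fderiv ℝ (φ.symm.trans ψ) y := by
  have hd : DifferentiableAt ℝ (φ.symm.trans ψ) y :=
    (contDiffAt_transition hφ hψ hy).differentiableAt (by simp)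
  have hψd : MDifferentiableAt (𝓡 n) (𝓡 n) ψ.symm (φ.symm.trans ψ y) :=
    (mdifferentiable_of_mem hψ).mdifferentiableAt_symm (ψ.map_source hy.2)
  have heq : φ.symm =ᶠ[nhds y] ψ.symm ∘ φ.symm.trans ψ := by
    filter_upwards [(φ.symm.trans ψ).open_source.mem_nhds hy] with z hz
      using (ψ.left_inv hz.2).symm
  have hcomp := mfderiv_comp y hψd hd.mdifferentiableAt
  rw [mfderiv_eq_fderiv] at hcomp
  exact heq.mfderiv_eq.trans hcomp

lemma chartPullback_eq_compContinuousLinearMap (hφ : φ ∈ IsManifold.maximalAtlas (𝓡 n) ∞ M)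
    (hψ : ψ ∈ IsManifold.maximalAtlas (𝓡 n) ∞ M) {y : EuclideanSpace ℝ (Fin n)}
    (hy : y ∈ (φ.symm.trans ψ).source) (θ : Form n p M) :
    chartPullback φ θ y = (chartPullback ψ θ (φ.symm.trans ψ y)).compContinuousLinearMap
      (fderiv ℝ (φ.symm.trans ψ) y) := by
  have hback : ψ.symm (φ.symm.trans ψ y) = φ.symm y := ψ.left_inv hy.2
  unfold chartPullback
  rw [hback]
  exact congrArg (θ.value (φ.symm y)).compContinuousLinearMap (coordDeriv_eq_comp_fderiv hφ hψ hy)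

lemma contDiffAt_coeff_of_transition {T : Type*} [NormedAddCommGroup T] [NormedSpace ℝ T]
    {η : T → Form n p M} (hφ : φ ∈ IsManifold.maximalAtlas (𝓡 n) ∞ M)
    (hψ : ψ ∈ IsManifold.maximalAtlas (𝓡 n) ∞ M) (t : T) {y : EuclideanSpace ℝ (Fin n)}
    (hy : y ∈ (φ.symm.trans ψ).source)
    (h : ContDiffAt ℝ ∞ (fun q : T × EuclideanSpace ℝ (Fin n) => coeff ψ (η q.1) q.2)
      (t, φ.symm.trans ψ y)) :
    ContDiffAt ℝ ∞ (fun q : T × EuclideanSpace ℝ (Fin n) => coeff φ (η q.1) q.2) (t, y) := by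
  rw [contDiffAt_coeff_iff] at h ⊢
  have hτ : ContDiffAt ℝ ∞ (fun q : T × EuclideanSpace ℝ (Fin n) => φ.symm.trans ψ q.2) (t, y) :=
    ContDiffAt.comp (t, y) (contDiffAt_transition hφ hψ hy) contDiffAt_snd
  have hdτ : ContDiffAt ℝ ∞
      (fun q : T × EuclideanSpace ℝ (Fin n) => fderiv ℝ (φ.symm.trans ψ) q.2) (t, y) :=
    ((contDiffAt_transition hφ hψ hy).fderiv_right (m := ∞) (by simp)).comp (t, y) contDiffAt_snd
  have hψη : ContDiffAt ℝ ∞ (fun q : T × EuclideanSpace ℝ (Fin n) =>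
      chartPullback ψ (η q.1) (φ.symm.trans ψ q.2)) (t, y) :=
    ContDiffAt.comp (t, y) (g := fun q : T × EuclideanSpace ℝ (Fin n) =>
      chartPullback ψ (η q.1) q.2) h (contDiffAt_fst.prodMk hτ)
  refine (contDiffAt_compContinuousLinearMap (EuclideanSpace.basisFun (Fin n) ℝ).toBasis
    hψη hdτ).congr_of_eventuallyEq ?_
  filter_upwards [continuous_snd.continuousAt.preimage_mem_nhds
    ((φ.symm.trans ψ).open_source.mem_nhds hy)] with q hq
  exact chartPullback_eq_compContinuousLinearMap hφ hψ hq (η q.1)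

end ChangeOfCoordinates

section SmoothFamilies

variable {l : ℕ} {η : EuclideanSpace ℝ (Fin l) → Form n p M}

lemma IsSmoothFamily.contDiffAt (hη : IsSmoothFamily η)
    (hφ : φ ∈ IsManifold.maximalAtlas (𝓡 n) ∞ M) (t : EuclideanSpace ℝ (Fin l))
    {y : EuclideanSpace ℝ (Fin n)} (hy : y ∈ φ.target) :
    ContDiffAt ℝ ∞ (fun q : EuclideanSpace ℝ (Fin l) × EuclideanSpace ℝ (Fin n) =>
      coeff φ (η q.1) q.2) (t, y) :=
  (hη φ hφ).contDiffAt ((isOpen_univ.prod φ.open_target).mem_nhds ⟨trivial, hy⟩)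

lemma IsSmoothFamily.contDiffAt_left (hη : IsSmoothFamily η)
    (hφ : φ ∈ IsManifold.maximalAtlas (𝓡 n) ∞ M) (t : EuclideanSpace ℝ (Fin l))
    {y : EuclideanSpace ℝ (Fin n)} (hy : y ∈ φ.target) :
    ContDiffAt ℝ ∞ (fun s => coeff φ (η s) y) t :=
  ContDiffAt.comp t (f := fun s => (s, y)) (hη.contDiffAt hφ t hy)
    (contDiff_prodMk_left y).contDiffAt

lemma IsSmoothFamily.isCk (hη : IsSmoothFamily η) (k : ℕ) (t : EuclideanSpace ℝ (Fin l)) :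
    IsCk k (η t) := fun _ hφ y hy =>
  (((hη.contDiffAt hφ t hy).comp y (contDiff_prodMk_right t).contDiffAt).of_le
    (by exact_mod_cast le_top)).contDiffWithinAt

variable [IsManifold (𝓡 n) ∞ M]

lemma value_eq_compContinuousLinearMap_chartPullback
    (hφ : φ ∈ IsManifold.maximalAtlas (𝓡 n) ∞ M) {x : M} (hx : x ∈ φ.source) (θ : Form n p M) :
    θ.value x = (chartPullback φ θ (φ x)).compContinuousLinearMap (mfderiv (𝓡 n) (𝓡 n) φ x) := by
  have hid := (mdifferentiable_of_mem hφ).symm_comp_deriv hx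
  ext u
  have happly : ∀ w : EuclideanSpace ℝ (Fin n),
      coordDeriv φ (φ x) (mfderiv (𝓡 n) (𝓡 n) φ x w) = w := fun w => congrArg (· w) hid
  change _ = θ.value (φ.symm (φ x)) fun a => coordDeriv φ (φ x) (mfderiv (𝓡 n) (𝓡 n) φ x (u a))
  simp only [happly, φ.left_inv hx]

lemma IsSmoothFamily.contDiff_value (hη : IsSmoothFamily η) (x : M) :
    ContDiff ℝ ∞ fun t => (η t).value x := by
  have hφ := IsManifold.chart_mem_maximalAtlas (I := 𝓡 n) (n := ∞) x
  have hx := mem_chart_source (EuclideanSpace ℝ (Fin n)) x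
  simp only [value_eq_compContinuousLinearMap_chartPullback hφ hx]
  refine contDiff_iff_contDiffAt.2 fun t =>
    contDiffAt_compContinuousLinearMap (EuclideanSpace.basisFun (Fin n) ℝ).toBasis
      (contDiffAt_coeff_iff.1 ?_) contDiffAt_const
  exact hη.contDiffAt_left hφ t ((chartAt _ x).map_source hx)

end SmoothFamilies

section FamilyDerivative

variable {T : Type*} [NormedAddCommGroup T] [NormedSpace ℝ T] {η : T → Form n p M}

/-- The derivative `∂_v η` of a family of forms in the direction `v` of the parameter, taken at each
point of `M` separately. -/
def familyDeriv (η : T → Form n p M) (v t : T) : Form n p M :=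
  fun x => fderiv ℝ (fun s => (η s).value x) t v

lemma familyDeriv_add (η : T → Form n p M) (v w t : T) :
    familyDeriv η (v + w) t = familyDeriv η v t + familyDeriv η w t :=
  funext fun x => map_add (fderiv ℝ (fun s => (η s).value x) t) v w

lemma familyDeriv_smul (η : T → Form n p M) (c : ℝ) (v t : T) :
    familyDeriv η (c • v) t = c • familyDeriv η v t :=
  funext fun x => map_smul (fderiv ℝ (fun s => (η s).value x) t) c v

lemma paramDeriv_coeff (φ : OpenPartialHomeomorph M (EuclideanSpace ℝ (Fin n)))
    {t : T} {y : EuclideanSpace ℝ (Fin n)}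
    (h : DifferentiableAt ℝ (fun s => (η s).value (φ.symm y)) t) (v : T) :
    paramDeriv v (fun s => coeff φ (η s)) t y = coeff φ (familyDeriv η v t) y := by
  let A : (EuclideanSpace ℝ (Fin n) [⋀^Fin p]→L[ℝ] ℝ) →L[ℝ] EuclideanSpace ℝ (Fin p ↪o Fin n) :=
    altCoeff (coordVector φ y)
  exact congrArg (· v) (A.hasFDerivAt.comp t h.hasFDerivAt).fderiv

end FamilyDerivative

section SmoothFamilies

variable {l : ℕ} {η : EuclideanSpace ℝ (Fin l) → Form n p M} [IsManifold (𝓡 n) ∞ M]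

lemma IsSmoothFamily.differentiableAt_value (hη : IsSmoothFamily η) (t : EuclideanSpace ℝ (Fin l))
    (x : M) : DifferentiableAt ℝ (fun s => (η s).value x) t :=
  (hη.contDiff_value x).differentiable (by simp) t

lemma IsSmoothFamily.familyDeriv (hη : IsSmoothFamily η) (v : EuclideanSpace ℝ (Fin l)) :
    IsSmoothFamily (familyDeriv η v) := by
  intro φ hφ
  have h : ContDiffOn ℝ ∞ (fun q : EuclideanSpace ℝ (Fin l) × EuclideanSpace ℝ (Fin n) =>
      fderiv ℝ (Function.uncurry fun s => coeff φ (η s)) q (v, 0)) (Set.univ ×ˢ φ.target) :=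
    ((hη φ hφ).fderiv_of_isOpen (isOpen_univ.prod φ.open_target) (m := ∞) (by simp)).clm_apply
      contDiffOn_const
  refine h.congr fun q hq => ?_
  rw [← paramDeriv_coeff φ (hη.differentiableAt_value q.1 _),
    paramDeriv_eq_fderiv_uncurry ((hη.contDiffAt hφ q.1 hq.2).differentiableAt (by simp))]

end SmoothFamilies

end Forms

section LocalCoefficients

variable {n p l : ℕ} {M : Type*} [TopologicalSpace M] [ChartedSpace (EuclideanSpace ℝ (Fin n)) M]
  {ι : Type*} (D : ChartPartition n M ι)

lemma ChartPartition.contDiffOn_pou (i : ι) :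
    ContDiffOn ℝ ∞ (fun y => D.pou i ((D.chart i).symm y)) (D.chart i).target :=
  ((D.pou i).contMDiff.comp_contMDiffOn
    (contMDiffOn_symm_of_mem_maximalAtlas (D.chart_mem i))).contDiffOn

variable {η : EuclideanSpace ℝ (Fin l) → Form n p M}

lemma IsSmoothFamily.contDiff_localCoeff [CompactSpace M] (hη : IsSmoothFamily η) (i : ι) :
    ContDiff ℝ ∞ (Function.uncurry fun t => D.localCoeff i (η t)) := by
  have hin : ContDiffOn ℝ ∞ (Function.uncurry fun t => D.localCoeff i (η t))
      (Set.univ ×ˢ (D.chart i).target) :=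
    (((D.contDiffOn_pou i).comp contDiff_snd.contDiffOn fun _ hq => hq.2).smul
      (hη _ (D.chart_mem i))).congr fun q hq => D.localCoeff_apply_of_mem i _ hq.2
  have hout : ContDiffOn ℝ ∞ (Function.uncurry fun t => D.localCoeff i (η t))
      (Set.univ ×ˢ (D.chart i '' tsupport (D.pou i))ᶜ) :=
    (contDiffOn_const (c := 0)).congr fun q hq => D.localCoeff_eq_zero i _ hq.2
  refine contDiff_of_contDiffOn_union_of_isOpen hin hout ?_
    (isOpen_univ.prod (D.chart i).open_target)
    (isOpen_univ.prod (D.isCompact_image i).isClosed.isOpen_compl)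
  have hK : D.chart i '' tsupport (D.pou i) ⊆ (D.chart i).target :=
    (Set.image_mono (D.subordinate i)).trans_eq (D.chart i).image_source_eq_target
  rw [← Set.prod_union, Set.union_comm, Set.compl_subset_iff_union.1 (by rwa [compl_compl]),
    Set.univ_prod_univ]

lemma IsSmoothFamily.eventually_norm_mpderiv_localCoeff_sub_lt [CompactSpace M]
    (hη : IsSmoothFamily η) (i : ι) (α : Fin n → ℕ) (t₀ : EuclideanSpace ℝ (Fin l)) {ε : ℝ}
    (hε : 0 < ε) : ∀ᶠ t in nhds t₀, ∀ y,
      ‖mpderiv α (D.localCoeff i (η t)) y - mpderiv α (D.localCoeff i (η t₀)) y‖ < ε :=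
  eventually_forall_norm_sub_lt (g := fun t => mpderiv α (D.localCoeff i (η t)))
    (contDiff_mpderiv_param α (hη.contDiff_localCoeff D i)).continuous (D.isCompact_image i)
    (fun t => mpderiv_eq_zero_of_notMem (D.isCompact_image i).isClosed
      (fun _ hz => D.localCoeff_eq_zero i (η t) hz) α) t₀ hε

variable [IsManifold (𝓡 n) ∞ M]

lemma ChartPartition.paramDeriv_localCoeff (hη : IsSmoothFamily η) (i : ι)
    (v t : EuclideanSpace ℝ (Fin l)) :
    paramDeriv v (fun s => D.localCoeff i (η s)) t = D.localCoeff i (familyDeriv η v t) := by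
  ext1 y
  by_cases hy : y ∈ (D.chart i).target
  · have hd : DifferentiableAt ℝ (fun s => coeff (D.chart i) (η s) y) t :=
      (hη.contDiffAt_left (D.chart_mem i) t hy).differentiableAt (by simp)
    simp only [paramDeriv, D.localCoeff_apply_of_mem i _ hy,
      ← paramDeriv_coeff (D.chart i) (hη.differentiableAt_value t _), fderiv_fun_const_smul hd,
      smul_apply]
  · simp [paramDeriv, localCoeff, hy]

lemma isSmoothFamily_of_contDiff_localCoeff
    (h : ∀ i, ContDiff ℝ ∞ (Function.uncurry fun t => D.localCoeff i (η t))) :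
    IsSmoothFamily η := by
  rintro φ hφ ⟨t, y⟩ ⟨-, hy⟩
  refine ContDiffAt.contDiffWithinAt ?_
  obtain ⟨i, hi⟩ := D.pou.exists_pos_of_mem (Set.mem_univ (φ.symm y))
  have hsource : φ.symm y ∈ (D.chart i).source := D.subordinate i (subset_tsupport _ hi.ne')
  have htarget : D.chart i (φ.symm y) ∈ (D.chart i).target := (D.chart i).map_source hsource
  refine contDiffAt_coeff_of_transition hφ (D.chart_mem i) t ⟨hy, hsource⟩ ?_
  have hpou : ContDiffAt ℝ ∞ (fun z => D.pou i ((D.chart i).symm z)) (D.chart i (φ.symm y)) :=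
    (D.contDiffOn_pou i).contDiffAt ((D.chart i).open_target.mem_nhds htarget)
  have hne : D.pou i ((D.chart i).symm (D.chart i (φ.symm y))) ≠ 0 := by
    rw [(D.chart i).left_inv hsource]
    exact hi.ne'
  have hinv := (hpou.inv hne).comp (t, D.chart i (φ.symm y)) contDiffAt_snd
  refine (hinv.smul (h i).contDiffAt).congr_of_eventuallyEq ?_
  have hne_near := hpou.continuousAt.eventually_ne hne
  filter_upwards [continuousAt_snd.eventually
    (hne_near.and ((D.chart i).open_target.mem_nhds htarget))] with q hq
  change _ = (D.pou i ((D.chart i).symm q.2))⁻¹ • D.localCoeff i (η q.1) q.2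
  rw [D.localCoeff_apply_of_mem i _ hq.2, inv_smul_smul₀ hq.1]

end LocalCoefficients

section Evaluation

/-- The multi-indices of order at most `k`, which label the partial derivatives that enter the
`C^k` norm. -/
abbrev MultiIndex (n k : ℕ) : Type := {α : Fin n → ℕ // ∑ i, α i ≤ k}

instance finite_multiIndex (n k : ℕ) : Finite (MultiIndex n k) :=
  ((Set.finite_Iic fun _ : Fin n => k).subset fun _ hα i =>
    (Finset.single_le_sum_of_canonicallyOrdered (Finset.mem_univ i)).trans hα).to_subtype

variable {n p : ℕ} {M : Type*} [TopologicalSpace M] [ChartedSpace (EuclideanSpace ℝ (Fin n)) M]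
  [CompactSpace M] [IsManifold (𝓡 n) ∞ M] {ι : Type*} (D : ChartPartition n M ι) {k : ℕ}

namespace CkForms

lemma contDiff_localCoeff (i : ι) (θ : CkForms p D k) {m : ℕ} (hm : m ≤ k) :
    ContDiff ℝ (m : ℕ∞) (D.localCoeff i θ.form) :=
  (D.contDiff_localCoeff i θ.isCk).of_le (by exact_mod_cast hm)

variable [Fintype ι]

lemma norm_mpderiv_localCoeff_le (i : ι) {α : Fin n → ℕ} (hα : ∑ j, α j ≤ k)
    (y : EuclideanSpace ℝ (Fin n)) (θ : CkForms p D k) :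
    ‖mpderiv α (D.localCoeff i θ.form) y‖ ≤ ‖θ‖ :=
  (norm_mpderiv_le_ckNorm hα (D.contDiff_localCoeff i θ.isCk)
    (D.hasCompactSupport_localCoeff i θ.form) y).trans
    (Finset.single_le_sum (f := fun i => ckNorm k (D.localCoeff i θ.form))
      (fun _ _ => ckNorm_nonneg k _) (Finset.mem_univ i))

/-- The functional `η ↦ ∂^α (φ_{i*} (λᵢ η)) (y)` on `C^k(M, Λ^p)`, for `|α| ≤ k`. -/
def evalCLM (i : ι) {α : Fin n → ℕ} (hα : ∑ j, α j ≤ k) (y : EuclideanSpace ℝ (Fin n)) :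
    CkForms p D k →L[ℝ] EuclideanSpace ℝ (Fin p ↪o Fin n) :=
  LinearMap.mkContinuous
    { toFun := fun θ => mpderiv α (D.localCoeff i θ.form) y
      map_add' := fun θ ξ => by
        have h := mpderiv_add (contDiff_localCoeff D i θ hα) (contDiff_localCoeff D i ξ hα)
        rw [← D.localCoeff_add] at h
        exact congrFun h y
      map_smul' := fun c θ => by
        have h := mpderiv_smul c (contDiff_localCoeff D i θ hα)
        rw [← D.localCoeff_smul] at h
        exact congrFun h y } 1
    fun θ => by
      rw [one_mul]
      exact norm_mpderiv_localCoeff_le D i hα y θ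

lemma evalCLM_apply (i : ι) {α : Fin n → ℕ} (hα : ∑ j, α j ≤ k) (y : EuclideanSpace ℝ (Fin n))
    (θ : CkForms p D k) : evalCLM D i hα y θ = mpderiv α (D.localCoeff i θ.form) y := rfl

lemma norm_evalCLM_le_one (i : ι) {α : Fin n → ℕ} (hα : ∑ j, α j ≤ k)
    (y : EuclideanSpace ℝ (Fin n)) : ‖(evalCLM D i hα y : CkForms p D k →L[ℝ] _)‖ ≤ 1 :=
  LinearMap.mkContinuous_norm_le _ zero_le_one _

lemma isNorming_evalCLM :
    IsNorming (Fintype.card ι *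
        (∑ j ∈ Finset.range (k + 1), (Finset.Nat.antidiagonalTuple n j).card : ℕ) + 1)
      fun q : ι × MultiIndex n k × EuclideanSpace ℝ (Fin n) =>
        (evalCLM D q.1 q.2.1.2 q.2.2 : CkForms p D k →L[ℝ] _) where
  pos := by positivity
  norm_le_one q := norm_evalCLM_le_one D q.1 q.2.1.2 q.2.2
  norm_le θ c hc h := by
    set N : ℕ := ∑ j ∈ Finset.range (k + 1), (Finset.Nat.antidiagonalTuple n j).card
    calc ‖θ‖ = ∑ i, ckNorm k (D.localCoeff i θ.form) := norm_def D k θ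
      _ ≤ ∑ _i : ι, N * c :=
          Finset.sum_le_sum fun i _ => ckNorm_le fun α hα y => h (i, ⟨α, hα⟩, y)
      _ = Fintype.card ι * N * c := by
          rw [Finset.sum_const, Finset.card_univ, nsmul_eq_mul, mul_assoc]
      _ ≤ (Fintype.card ι * N + 1) * c := by
          gcongr
          exact le_add_of_nonneg_right zero_le_one

end CkForms

end Evaluation

section Joint

variable {n p : ℕ} {M : Type*} [TopologicalSpace M] [ChartedSpace (EuclideanSpace ℝ (Fin n)) M]
  [CompactSpace M] [IsManifold (𝓡 n) ∞ M] {ι : Type*} [Fintype ι] (D : ChartPartition n M ι) {k : ℕ}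

namespace CkForms

lemma sum_add_single (α : Fin n → ℕ) (j : Fin n) :
    ∑ r, (α + Pi.single j 1 : Fin n → ℕ) r = ∑ r, α r + 1 := by
  simp [Finset.sum_add_distrib]

/-- The derivative of `y ↦ evalCLM D i _ y` in the operator norm. -/
def evalDeriv (i : ι) {α : Fin n → ℕ} (hα : ∑ j, α j + 1 ≤ k) (y : EuclideanSpace ℝ (Fin n)) :
    EuclideanSpace ℝ (Fin n) →L[ℝ] CkForms p D k →L[ℝ] EuclideanSpace ℝ (Fin p ↪o Fin n) :=
  ∑ j, (EuclideanSpace.proj j).smulRight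
    (evalCLM D i (α := α + Pi.single j 1) ((sum_add_single α j).trans_le hα) y)

lemma hasFDerivAt_evalCLM_apply (i : ι) {α : Fin n → ℕ} (hα : ∑ j, α j + 1 ≤ k)
    (θ : CkForms p D k) (y : EuclideanSpace ℝ (Fin n)) :
    HasFDerivAt (fun z => evalCLM D i (Nat.le_of_succ_le hα) z θ)
      (ContinuousLinearMap.apply ℝ _ θ ∘L evalDeriv D i hα y) y := by
  refine (hasFDerivAt_mpderiv α (contDiff_localCoeff D i θ hα) y).congr_fderiv ?_
  ext1 w
  simp [evalDeriv, evalCLM_apply]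

lemma norm_evalDeriv_le (i : ι) {α : Fin n → ℕ} (hα : ∑ j, α j + 1 ≤ k)
    (y : EuclideanSpace ℝ (Fin n)) : ‖(evalDeriv D i hα y : _ →L[ℝ] CkForms p D k →L[ℝ] _)‖ ≤
      ∑ j, ‖(EuclideanSpace.proj j : EuclideanSpace ℝ (Fin n) →L[ℝ] ℝ)‖ := by
  refine norm_sum_le_of_le
    (E := EuclideanSpace ℝ (Fin n) →L[ℝ] CkForms p D k →L[ℝ] EuclideanSpace ℝ (Fin p ↪o Fin n))
    Finset.univ fun j _ => ?_
  rw [ContinuousLinearMap.norm_smulRight_apply]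
  exact mul_le_of_le_one_right (norm_nonneg _) (norm_evalCLM_le_one D i _ y)

/-- Bounding one further derivative makes `y ↦ evalCLM D i _ y` continuous in the operator norm,
which is why one order of differentiability is lost. -/
lemma contDiff_evalCLM (i : ι) (m : ℕ) {α : Fin n → ℕ} (hα : ∑ j, α j + m + 1 ≤ k) :
    ContDiff ℝ m fun y => (evalCLM D i (show ∑ j, α j ≤ k by omega) y : CkForms p D k →L[ℝ] _) := by
  induction m generalizing α with
  | zero =>
    exact contDiff_zero.2 <|
      (isNorming_apply (CkForms p D k)
        (EuclideanSpace ℝ (Fin p ↪o Fin n))).continuous_of_norm_deriv_le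
        (fun θ y => hasFDerivAt_evalCLM_apply D i hα (θ : CkForms p D k) y)
        (norm_evalDeriv_le D i hα)
  | succ m ih =>
    have hα₁ : ∑ j, α j + 1 ≤ k := by omega
    have hderiv : ContDiff ℝ m (evalDeriv (p := p) D i hα₁) :=
      ContDiff.sum fun j _ => contDiff_const.smulRight <|
        ih (α := α + Pi.single j 1) (by rw [sum_add_single]; omega)
    push_cast
    exact contDiff_succ_iff_hasFDerivAt.2 ⟨evalDeriv D i hα₁, hderiv, fun y =>
      (isNorming_apply (CkForms p D k) (EuclideanSpace ℝ (Fin p ↪o Fin n))).hasFDerivAt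
        (fun θ z => hasFDerivAt_evalCLM_apply D i hα₁ (θ : CkForms p D k) z)
        hderiv.continuous.continuousAt⟩

end CkForms

variable {D} {l : ℕ} {η : EuclideanSpace ℝ (Fin l) → Form n p M}

lemma isSmoothFamily_of_contDiff_mk
    (h : ∀ k : ℕ, ∃ hη : ∀ t, IsCk k (η t),
      ContDiff ℝ ∞ fun t => (CkForms.mk (η t) (hη t) : CkForms p D k)) : IsSmoothFamily η := by
  refine isSmoothFamily_of_contDiff_localCoeff D fun i => contDiff_infty.2 fun m => ?_
  obtain ⟨hη, hmk⟩ := h (m + 1)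
  have heval : ContDiff ℝ m fun q : EuclideanSpace ℝ (Fin l) × EuclideanSpace ℝ (Fin n) =>
      CkForms.evalCLM D i (α := 0) (by simp) q.2 (CkForms.mk (η q.1) (hη q.1) :
        CkForms p D (m + 1)) :=
    ((CkForms.contDiff_evalCLM D i m (by simp)).comp contDiff_snd).clm_apply
      ((hmk.of_le (by exact_mod_cast le_top)).comp contDiff_fst)
  simp only [CkForms.evalCLM_apply, mpderiv_zero] at heval
  exact heval

end Joint

section Curve

variable {n p l : ℕ} {M : Type*} [TopologicalSpace M] [ChartedSpace (EuclideanSpace ℝ (Fin n)) M]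
  [CompactSpace M] [IsManifold (𝓡 n) ∞ M] {ι : Type*} [Fintype ι]
  {η : EuclideanSpace ℝ (Fin l) → Form n p M}

namespace IsSmoothFamily

/-- The map `t ↦ η t` into `C^k(M, Λ^p)`. -/
def toCk (hη : IsSmoothFamily η) (D : ChartPartition n M ι) (k : ℕ)
    (t : EuclideanSpace ℝ (Fin l)) : CkForms p D k :=
  CkForms.mk (η t) (hη.isCk k t)

/-- The candidate for the derivative of the map `t ↦ η t` into `C^k(M, Λ^p)`, with values
`v ↦ ∂_v η`. -/
def derivCLM (hη : IsSmoothFamily η) (D : ChartPartition n M ι) (k : ℕ)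
    (t : EuclideanSpace ℝ (Fin l)) : EuclideanSpace ℝ (Fin l) →L[ℝ] CkForms p D k :=
  LinearMap.toContinuousLinearMap
    { toFun := fun v => (hη.familyDeriv v).toCk D k t
      map_add' := fun v w => Subtype.ext (familyDeriv_add η v w t)
      map_smul' := fun c v => Subtype.ext (familyDeriv_smul η c v t) }

variable (hη : IsSmoothFamily η) (D : ChartPartition n M ι) (k : ℕ)
include hη

lemma continuous_toCk : Continuous (hη.toCk D k) := by
  refine continuous_iff_continuousAt.2 fun t₀ =>
    (CkForms.isNorming_evalCLM D).continuousAt fun ε hε => ?_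
  have hε_all : ∀ᶠ t in nhds t₀, ∀ (i : ι) (α : MultiIndex n k) (y : EuclideanSpace ℝ (Fin n)),
      ‖mpderiv α (D.localCoeff i (η t)) y - mpderiv α (D.localCoeff i (η t₀)) y‖ < ε :=
    Filter.eventually_all.2 fun i => Filter.eventually_all.2 fun α =>
      hη.eventually_norm_mpderiv_localCoeff_sub_lt D i α t₀ hε
  filter_upwards [hε_all] with t ht
  rintro ⟨i, α, y⟩
  simp only [CkForms.evalCLM_apply]
  exact (ht i α y).le

lemma hasFDerivAt_evalCLM_toCk (i : ι) {α : Fin n → ℕ} (hα : ∑ j, α j ≤ k)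
    (y : EuclideanSpace ℝ (Fin n)) (t : EuclideanSpace ℝ (Fin l)) :
    HasFDerivAt (fun s => CkForms.evalCLM D i hα y (hη.toCk D k s))
      (CkForms.evalCLM D i hα y ∘L hη.derivCLM D k t) t := by
  have hloc := hη.contDiff_localCoeff D i
  have hd : Differentiable ℝ fun s => mpderiv α (D.localCoeff i (η s)) y :=
    ((contDiff_mpderiv_param α hloc).comp (contDiff_prodMk_left y)).differentiable (by simp)
  refine (hd t).hasFDerivAt.congr_fderiv ?_
  ext1 v
  calc paramDeriv v (fun s => mpderiv α (D.localCoeff i (η s))) t y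
      = mpderiv α (paramDeriv v (fun s => D.localCoeff i (η s)) t) y :=
        congrFun (mpderiv_paramDeriv α v hloc t).symm y
    _ = mpderiv α (D.localCoeff i (FormFamily.familyDeriv η v t)) y := by
        rw [D.paramDeriv_localCoeff hη]

lemma continuous_derivCLM : Continuous (hη.derivCLM D k) :=
  continuous_clm_apply.2 fun v => (hη.familyDeriv v).continuous_toCk D k

lemma hasFDerivAt_toCk (t : EuclideanSpace ℝ (Fin l)) :
    HasFDerivAt (hη.toCk D k) (hη.derivCLM D k t) t :=
  (CkForms.isNorming_evalCLM D).hasFDerivAt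
    (fun q s => hη.hasFDerivAt_evalCLM_toCk D k q.1 q.2.1.2 q.2.2 s)
    (hη.continuous_derivCLM D k).continuousAt

lemma contDiff_toCk : ContDiff ℝ ∞ (hη.toCk D k) := by
  refine contDiff_infty.2 fun m => ?_
  induction m generalizing η with
  | zero => exact contDiff_zero.2 (hη.continuous_toCk D k)
  | succ m ih =>
    push_cast
    exact contDiff_succ_iff_hasFDerivAt.2 ⟨hη.derivCLM D k,
      contDiff_clm_apply_iff.2 fun v => ih (hη.familyDeriv v), hη.hasFDerivAt_toCk D k⟩

end IsSmoothFamily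

end Curve

end FormFamily
end

theorem theorem2 (n p l : ℕ) {M : Type*} [TopologicalSpace M] [T2Space M] [CompactSpace M]
    [ChartedSpace (EuclideanSpace ℝ (Fin n)) M] [IsManifold (𝓡 n) ∞ M]
    {ι : Type*} [Fintype ι] (D : FormFamily.ChartPartition n M ι)
    (η : EuclideanSpace ℝ (Fin l) → FormFamily.Form n p M) :
    FormFamily.IsSmoothFamily η ↔
      ∀ k : ℕ, ∃ hη : ∀ t, FormFamily.IsCk k (η t),
        ContDiff ℝ ∞ (fun t => (FormFamily.CkForms.mk (η t) (hη t) : FormFamily.CkForms p D k)) :=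
  ⟨fun h k => ⟨h.isCk k, h.contDiff_toCk D k⟩, FormFamily.isSmoothFamily_of_contDiff_mk⟩
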